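/- Throughout, groupoids are locally compact Hausdorff topological groupoids with continuous structure maps. Such a groupoid $G$, with unit space $G^{(0)}\subseteq G$, range and source maps $r,s:G\to G^{(0)}$, is called ample if $r$, regarded as a map $G\to G$, is a local homeomorphism and $G^{(0)}$ is totally disconnected. For $A,B\subseteq G$ and $x\in G^{(0)}$ put $AB=\{ab\mid a\in A,\ b\in B,\ s(a)=r(b)\}$ and $Ax=\{a\in A\mid s(a)=x\}$. An elementary subgroupoid of $G$ is a compact open subgroupoid $K\subseteq G$ with $K^{(0)}=G^{(0)}$ that is principal, i.e. $g\in K$ and $s(g)=r(g)$ imply $g\in G^{(0)}$. An ample groupoid $G$ with compact unit space is almost finite if for every compact $C\subseteq G$ and every $\varepsilon>0$ there is an elementary subgroupoid $K\subseteq G$ with $$\frac{|CKx\setminus Kx|}{|Kx|}<\varepsilon\qquad\text{for all }x\in G^{(0)}.$$ The space $C_c(G)$ of continuous compactly supported functions $G\to\mathbb{C}$ carries the convolution product $(f_1f_2)(g)=\sum_{h\in G,\,r(h)=r(g)}f_1(h)f_2(h^{-1}g)$, and contains $C(G^{(0)})$ (when $G^{(0)}$ is compact) and $C_c(K)$ ($K\subseteq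 G$ an open subgroupoid) via extension by zero. The reduced $C^*$-algebra $C_r^*(G)$ is the completion of $C_c(G)$ in the norm $\|f\|=\sup_{x\in G^{(0)}}\|\pi_x(f)\|$, where $\pi_x(f)\xi=f\xi$ (convolution) on $\ell^2(Gx)$. Projections $p,q$ in a $C^*$-algebra $A$ are Murray--von Neumann equivalent in $A$, written $p\sim q$, if $p=vv^*$ and $q=v^*v$ for some $v\in A$. **Lemma.** Let $G$ be an almost finite ample groupoid with compact unit space. For every finite subset $F\subseteq C_c(G)$ and every $n\in\mathbb{N}$ there exist an elementary subgroupoid $K\subseteq G$ and a clopen subset $W\subseteq G^{(0)}$ such that, for $p:=\chi_W\in C(G^{(0)})$ and $1:=\chi_{G^{(0)}}$: 1. $f(1-p)\in C_c(K)$ and $(1-p)f\in C_c(K)$ for all $f\in F$; 2. there exist $n$ mutually orthogonal projections $p_1,\dots,p_n\in C(G^{(0)})$ such that $p_i\sim p$ in $C_r^*(G)$ for all $1\le i\le n$. -/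

import Mathlib

open scoped CompactlySupported ENNReal lp

noncomputable section

/-! ### Topological groupoids -/

/-- A groupoid, presented by its set `G` of arrows; units are particular arrows.
The product `g * h` is meaningful only for composable pairs, `src g = rng h`: the laws constrain
only these products, and the values of `*` on other pairs are never used. -/
class AlgGroupoid (G : Type*) extends Mul G, Inv G where
  src : G → G
  rng : G → G
  src_src : ∀ g, src (src g) = src g
  rng_src : ∀ g, rng (src g) = src g
  src_rng : ∀ g, src (rng g) = rng g
  rng_rng : ∀ g, rng (rng g) = rng g
  src_mul : ∀ g h, src g = rng h → src (g * h) = src h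
  rng_mul : ∀ g h, src g = rng h → rng (g * h) = rng g
  mul_assoc' : ∀ g h k, src g = rng h → src h = rng k → g * h * k = g * (h * k)
  mul_src : ∀ g, g * src g = g
  rng_mul_self : ∀ g, rng g * g = g
  src_inv : ∀ g, src g⁻¹ = rng g
  rng_inv : ∀ g, rng g⁻¹ = src g
  inv_mul_self : ∀ g, g⁻¹ * g = src g
  mul_inv_self : ∀ g, g * g⁻¹ = rng g

namespace AlgGroupoid

/-- The unit space `G⁽⁰⁾`, as a subset of `G`. -/
def units (G : Type*) [AlgGroupoid G] : Set G := Set.range (rng : G → G)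

/-- The product `A B = {a b | a ∈ A, b ∈ B, s(a) = r(b)}` of two sets of arrows. -/
def setMul {G : Type*} [AlgGroupoid G] (A B : Set G) : Set G :=
  {g | ∃ a ∈ A, ∃ b ∈ B, src a = rng b ∧ g = a * b}

/-- For a set of arrows `A` and a unit `x`, the set `A x = {a ∈ A | s(a) = x}`. -/
def fiber {G : Type*} [AlgGroupoid G] (A : Set G) (x : G) : Set G := {a ∈ A | src a = x}

/-- `K` is a subgroupoid of `G`. -/
structure IsSubgroupoid {G : Type*} [AlgGroupoid G] (K : Set G) : Prop where
  mul_mem : ∀ g ∈ K, ∀ h ∈ K, src g = rng h → g * h ∈ K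
  inv_mem : ∀ g ∈ K, g⁻¹ ∈ K

end AlgGroupoid

open AlgGroupoid in
/-- Étale groupoids; all topological groupoids are locally compact and Hausdorff, and all
structure maps are continuous. The range map, viewed as a map `G → G`, is a local
homeomorphism. -/
class EtaleGroupoid (G : Type*) [TopologicalSpace G] [AlgGroupoid G] : Prop
    extends T2Space G, LocallyCompactSpace G where
  continuous_src : Continuous (src : G → G)
  continuous_rng : Continuous (rng : G → G)
  continuous_inv' : Continuous (fun g : G => g⁻¹)
  continuousOn_mul : ContinuousOn (fun x : G × G => x.1 * x.2) {x | src x.1 = rng x.2}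
  isLocalHomeomorph_rng : IsLocalHomeomorph (rng : G → G)

/-- Ample groupoids: étale groupoids with totally disconnected unit space. -/
class AmpleGroupoid (G : Type*) [TopologicalSpace G] [AlgGroupoid G] : Prop
    extends EtaleGroupoid G where
  totallyDisconnected_units : IsTotallyDisconnected (AlgGroupoid.units G)

namespace AlgGroupoid

/-! ### Almost finiteness -/

/-- Elementary subgroupoids: compact open principal subgroupoids `K ⊆ G` with `K⁽⁰⁾ = G⁽⁰⁾`. -/
structure IsElementary {G : Type*} [TopologicalSpace G] [AlgGroupoid G] (K : Set G) : Prop where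
  isSubgroupoid : IsSubgroupoid K
  units_eq : K ∩ units G = units G
  isCompact : IsCompact K
  isOpen : IsOpen K
  principal : ∀ g ∈ K, src g = rng g → g ∈ units G

/-- `(C, ε)`-invariance of `K`: for all units `x`, `|CKx \ Kx| / |Kx| < ε`. It is applied to compact
sets `C` and `K` in étale groupoids only, for which the two sets counted are finite. -/
def IsInvariantSub {G : Type*} [AlgGroupoid G] (C : Set G) (ε : ℝ) (K : Set G) : Prop :=
  ∀ x ∈ units G,
    ((setMul C (fiber K x) \ fiber K x).ncard : ℝ) / ((fiber K x).ncard : ℝ) < ε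

/-- Almost finiteness (of an ample groupoid with compact unit space). -/
def IsAlmostFinite (G : Type*) [TopologicalSpace G] [AlgGroupoid G] : Prop :=
  ∀ C : Set G, IsCompact C → ∀ ε : ℝ, 0 < ε → ∃ K : Set G, IsElementary K ∧ IsInvariantSub C ε K

/-! ### Convolution -/

/-- The convolution `(f * k)(g) = ∑_{h ∈ G^{r(g)}} f(h) k(h⁻¹ g)`. For `f ∈ C_c(G)` only finitely
many summands are nonzero. -/
def conv {G : Type*} [AlgGroupoid G] (f k : G → ℂ) (g : G) : ℂ :=
  ∑' h : {h : G // rng h = rng g}, f h * k ((h : G)⁻¹ * g)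

/-- For an open subgroupoid `K ⊆ G`, the subspace `C_c(K)` of `C_c(G)` (functions on `K` are
extended by zero), as a set of functions on `G`. -/
def CcOn {G : Type*} [TopologicalSpace G] (K : Set G) : Set (G → ℂ) :=
  {f | Continuous f ∧ HasCompactSupport f ∧ tsupport f ⊆ K}

theorem fiber_bound {G : Type*} [TopologicalSpace G] {φ : G → G} (hφ : IsLocallyInjective φ) {S : Set G} (hS : IsCompact S) :
    ∃ N : ℕ, ∀ x, (S ∩ φ ⁻¹' {x}).encard ≤ N := by
  refine hS.induction_on (p := fun S => ∃ N : ℕ, ∀ x, (S ∩ φ ⁻¹' {x}).encard ≤ N) ?_ ?_ ?_ ?_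
  · exact ⟨0, fun x => by simp⟩
  · rintro s t hst ⟨N, hN⟩
    exact ⟨N, fun x => (Set.encard_le_encard (by gcongr)).trans (hN x)⟩
  · rintro s t ⟨N, hN⟩ ⟨M, hM⟩
    refine ⟨N + M, fun x => ?_⟩
    rw [Set.union_inter_distrib_right]
    push_cast
    exact (Set.encard_union_le _ _).trans (add_le_add (hN x) (hM x))
  · intro x _
    obtain ⟨U, hU, hi⟩ := isLocallyInjective_iff_nhds.1 hφ x
    refine ⟨U, mem_nhdsWithin_of_mem_nhds hU, 1, fun y => ?_⟩
    rw [Nat.cast_one, Set.encard_le_one_iff]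
    rintro a b ⟨ha, ha'⟩ ⟨hb, hb'⟩
    exact hi ha hb (ha'.trans hb'.symm)

section lemmas

variable {G : Type*} [AlgGroupoid G]

theorem inv_inv' (g : G) : g⁻¹⁻¹ = g := by
  have h1 : src (g⁻¹⁻¹) = rng g⁻¹ := by rw [src_inv]
  have h2 : src g⁻¹ = rng g := src_inv g
  calc g⁻¹⁻¹ = g⁻¹⁻¹ * src (g⁻¹⁻¹) := (mul_src _).symm
    _ = g⁻¹⁻¹ * (g⁻¹ * g) := by rw [h1, rng_inv, inv_mul_self]
    _ = g⁻¹⁻¹ * g⁻¹ * g := (mul_assoc' _ _ _ h1 h2).symm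
    _ = rng g * g := by rw [inv_mul_self, h2]
    _ = g := rng_mul_self g

theorem mul_inv_mul (h g : G) (e : rng h = rng g) : h * (h⁻¹ * g) = g := by
  rw [← mul_assoc' _ _ _ (rng_inv h).symm ((src_inv h).trans e), mul_inv_self, e, rng_mul_self]

theorem mem_units_iff (g : G) : g ∈ units G ↔ rng g = g :=
  ⟨by rintro ⟨h, rfl⟩; exact rng_rng h, fun h => ⟨g, h⟩⟩

variable [TopologicalSpace G] [EtaleGroupoid G]

theorem isClopen_units : IsClopen (units G) := by
  constructor
  · have : units G = {g | rng g = g} := Set.ext mem_units_iff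
    rw [this]
    exact isClosed_eq EtaleGroupoid.continuous_rng continuous_id
  · exact (EtaleGroupoid.isLocalHomeomorph_rng (G := G)).isOpenMap.isOpen_range

theorem locInj_rng : IsLocallyInjective (rng : G → G) :=
  (EtaleGroupoid.isLocalHomeomorph_rng (G := G)).isLocallyInjective

theorem locInj_src : IsLocallyInjective (src : G → G) := by
  have h : (src : G → G) = rng ∘ fun g => g⁻¹ := funext fun g => (rng_inv g).symm
  rw [h]
  exact (locInj_rng (G := G)).comp_right EtaleGroupoid.continuous_inv'
    (fun a b (e : a⁻¹ = b⁻¹) => by rw [← inv_inv' a, e, inv_inv'])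

/-- A Schur type estimate: `‖f * ξ‖₂² ≤ C ‖ξ‖₂²` for `f ∈ C_c(G)`. -/
theorem exists_conv_bound (f : C_c(G, ℂ)) : ∃ C : NNReal, ∀ ξ : G → ℂ,
    ∑' g, ‖conv f ξ g‖ₑ ^ 2 ≤ C * ∑' g, ‖ξ g‖ₑ ^ 2 := by
  classical
  have hS : IsCompact (tsupport f) := f.hasCompactSupport
  obtain ⟨N, hN⟩ := fiber_bound (locInj_rng (G := G)) hS
  obtain ⟨N', hN'⟩ := fiber_bound (locInj_src (G := G)) hS
  obtain ⟨M, hM⟩ : ∃ M : NNReal, ∀ g, ‖f g‖ₑ ≤ M := by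
    obtain ⟨M, hM⟩ := f.hasCompactSupport.exists_bound_of_continuous f.continuous
    refine ⟨M.toNNReal, fun g => ?_⟩
    rw [← ofReal_norm]
    exact ENNReal.ofReal_le_ofReal (hM g)
  refine ⟨M ^ 2 * N * N', fun ξ => ?_⟩
  set e : G → G → G → ℝ≥0∞ := fun g h k =>
    if h ∈ tsupport f ∧ src h = rng k ∧ g = h * k then ‖ξ k‖ₑ ^ 2 else 0 with he
  have key : ∀ g, ‖conv f ξ g‖ₑ ^ 2 ≤ (M ^ 2 * N : ℝ≥0∞) * ∑' h, ∑' k, e g h k := by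
    intro g
    have hfin : (tsupport f ∩ rng ⁻¹' {rng g}).Finite :=
      Set.finite_of_encard_le_coe (hN _)
    have hcard : (hfin.toFinset.card : ℝ≥0∞) ≤ N := by
      have := hN (rng g)
      rw [hfin.encard_eq_coe_toFinset_card] at this
      exact_mod_cast this
    have h1 : conv f ξ g = ∑ h ∈ hfin.toFinset, f h * ξ (h⁻¹ * g) := by
      unfold conv
      have : ∀ h : {h : G // rng h = rng g},
          f h * ξ ((h : G)⁻¹ * g) = (fun h : G => f h * ξ (h⁻¹ * g)) h := fun _ => rfl
      rw [tsum_congr this]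
      rw [show (∑' h : {h : G // rng h = rng g}, (fun h : G => f h * ξ (h⁻¹ * g)) h) =
        ∑' h : G, Set.indicator {h | rng h = rng g} (fun h : G => f h * ξ (h⁻¹ * g)) h from
        tsum_subtype {h | rng h = rng g} (fun h : G => f h * ξ (h⁻¹ * g))]
      rw [tsum_eq_sum (s := hfin.toFinset)]
      · refine Finset.sum_congr rfl fun h hh => ?_
        rw [Set.Finite.mem_toFinset] at hh
        exact Set.indicator_of_mem (s := {h | rng h = rng g}) hh.2 _
      · intro h hh
        rw [Set.Finite.mem_toFinset] at hh
        by_cases h2 : rng h = rng g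
        · have : f h = 0 := by
            by_contra h3
            exact hh ⟨subset_tsupport f h3, h2⟩
          simp [this]
        · exact Set.indicator_of_notMem (s := {h | rng h = rng g}) h2 _
    have h2 : ‖conv f ξ g‖ₑ ≤ M * ∑ h ∈ hfin.toFinset, ‖ξ (h⁻¹ * g)‖ₑ := by
      rw [h1, Finset.mul_sum]
      refine (enorm_sum_le _ _).trans (Finset.sum_le_sum fun h _ => ?_)
      rw [enorm_mul]
      gcongr
      exact hM h
    have h3 : ∀ h ∈ hfin.toFinset, ‖ξ (h⁻¹ * g)‖ₑ ^ 2 ≤ ∑' k, e g h k := by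
      intro h hh
      rw [Set.Finite.mem_toFinset] at hh
      have hr : rng h = rng g := hh.2
      refine le_trans (le_of_eq ?_) (ENNReal.le_tsum (h⁻¹ * g))
      rw [he]
      have a1 : src h = rng (h⁻¹ * g) := by
        rw [rng_mul _ _ ((src_inv h).trans hr), rng_inv]
      simp only [hh.1, a1, mul_inv_mul h g hr, and_self, if_true]
    have h4 : (∑ h ∈ hfin.toFinset, ‖ξ (h⁻¹ * g)‖ₑ) ^ 2 ≤
        N * ∑ h ∈ hfin.toFinset, ‖ξ (h⁻¹ * g)‖ₑ ^ 2 := by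
      have cs := sq_sum_le_card_mul_sum_sq (s := hfin.toFinset) (f := fun h => ‖ξ (h⁻¹ * g)‖₊)
      have cs' : (∑ h ∈ hfin.toFinset, ‖ξ (h⁻¹ * g)‖ₑ) ^ 2 ≤
          hfin.toFinset.card * ∑ h ∈ hfin.toFinset, ‖ξ (h⁻¹ * g)‖ₑ ^ 2 := by
        simp only [enorm_eq_nnnorm]
        exact_mod_cast cs
      exact cs'.trans (by gcongr)
    calc ‖conv f ξ g‖ₑ ^ 2 ≤ (M * ∑ h ∈ hfin.toFinset, ‖ξ (h⁻¹ * g)‖ₑ) ^ 2 := by gcongr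
      _ = M ^ 2 * (∑ h ∈ hfin.toFinset, ‖ξ (h⁻¹ * g)‖ₑ) ^ 2 := mul_pow _ _ _
      _ ≤ M ^ 2 * (N * ∑ h ∈ hfin.toFinset, ‖ξ (h⁻¹ * g)‖ₑ ^ 2) := by gcongr
      _ ≤ M ^ 2 * (N * ∑ h ∈ hfin.toFinset, ∑' k, e g h k) := by
          gcongr with h hh
          exact h3 h hh
      _ ≤ M ^ 2 * (N * ∑' h, ∑' k, e g h k) := by
          gcongr
          exact ENNReal.sum_le_tsum _
      _ = _ := (mul_assoc _ _ _).symm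
  have swap : ∑' g, ∑' h, ∑' k, e g h k ≤ N' * ∑' k, ‖ξ k‖ₑ ^ 2 := by
    have e1 : ∑' g, ∑' h, ∑' k, e g h k = ∑' k, ∑' h, ∑' g, e g h k := by
      calc ∑' g, ∑' h, ∑' k, e g h k = ∑' g, ∑' k, ∑' h, e g h k :=
            tsum_congr fun g => ENNReal.tsum_comm
        _ = ∑' k, ∑' g, ∑' h, e g h k := ENNReal.tsum_comm
        _ = _ := tsum_congr fun k => ENNReal.tsum_comm
    rw [e1, ← ENNReal.tsum_mul_left]
    refine ENNReal.tsum_le_tsum fun k => ?_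
    have e2 : ∀ h, ∑' g, e g h k =
        Set.indicator (tsupport f ∩ src ⁻¹' {rng k}) (fun _ => ‖ξ k‖ₑ ^ 2) h := by
      intro h
      rw [tsum_eq_single (h * k)]
      · simp [he, Set.indicator_apply]
      · intro g hg
        simp [he, hg]
    rw [tsum_congr e2, ← tsum_subtype, ENNReal.tsum_set_const]
    gcongr
    have := hN' (rng k)
    exact_mod_cast this
  calc ∑' g, ‖conv f ξ g‖ₑ ^ 2 ≤ ∑' g, (M ^ 2 * N : ℝ≥0∞) * ∑' h, ∑' k, e g h k :=
        ENNReal.tsum_le_tsum key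
    _ = (M ^ 2 * N : ℝ≥0∞) * ∑' g, ∑' h, ∑' k, e g h k := ENNReal.tsum_mul_left
    _ ≤ (M ^ 2 * N : ℝ≥0∞) * (N' * ∑' k, ‖ξ k‖ₑ ^ 2) := by gcongr
    _ = _ := by push_cast; ring

/-- For `f ∈ C_c(G)`, only finitely many terms of the convolution sum are nonzero. -/
theorem summable_conv (f : C_c(G, ℂ)) (ξ : G → ℂ) (g : G) :
    Summable fun h : {h : G // rng h = rng g} => f h * ξ ((h : G)⁻¹ * g) := by
  obtain ⟨N, hN⟩ := fiber_bound (locInj_rng (G := G)) (S := tsupport f) f.hasCompactSupport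
  have hfin : (tsupport f ∩ rng ⁻¹' {rng g}).Finite := Set.finite_of_encard_le_coe (hN _)
  refine summable_of_hasFiniteSupport ((hfin.preimage Subtype.val_injective.injOn).subset ?_)
  intro h hh
  refine ⟨subset_tsupport f fun h0 => hh ?_, h.2⟩
  simp [h0]

/-- Boundedness in the form needed to define an operator on `ℓ²(G)`. -/
theorem exists_conv_bound_real (f : C_c(G, ℂ)) : ∃ C : ℝ, 0 ≤ C ∧ ∀ ξ : ℓ^2(G, ℂ),
    ∀ s : Finset G, ∑ g ∈ s, ‖conv f ξ g‖ ^ (2 : ℝ≥0∞).toReal ≤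
      (C * ‖ξ‖) ^ (2 : ℝ≥0∞).toReal := by
  obtain ⟨C, hC⟩ := exists_conv_bound f
  refine ⟨Real.sqrt C, Real.sqrt_nonneg _, fun ξ s => ?_⟩
  have hn : ‖ξ‖ ^ 2 = ∑' g, ‖ξ g‖ ^ 2 := by
    simpa using lp.norm_rpow_eq_tsum (p := 2) (by simp) ξ
  have hs : Summable fun g => ‖ξ g‖ ^ 2 := by
    simpa using (lp.memℓp ξ).summable (p := 2) (by simp)
  have h1 : ∑' g, ‖ξ g‖ₑ ^ 2 = ENNReal.ofReal (‖ξ‖ ^ 2) := by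
    rw [hn, ENNReal.ofReal_tsum_of_nonneg (fun _ => by positivity) hs]
    refine tsum_congr fun g => ?_
    rw [ENNReal.ofReal_pow (norm_nonneg _), ofReal_norm]
  have h2 : ENNReal.ofReal (∑ g ∈ s, ‖conv f ξ g‖ ^ 2) ≤ ENNReal.ofReal (C * ‖ξ‖ ^ 2) := by
    rw [ENNReal.ofReal_sum_of_nonneg (fun _ _ => by positivity),
      ENNReal.ofReal_mul C.coe_nonneg, ENNReal.ofReal_coe_nnreal, ← h1]
    refine le_trans ?_ (hC ξ)
    refine le_trans (le_of_eq ?_) (ENNReal.sum_le_tsum s)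
    refine Finset.sum_congr rfl fun g _ => ?_
    rw [ENNReal.ofReal_pow (norm_nonneg _), ofReal_norm]
  have h3 := (ENNReal.ofReal_le_ofReal_iff (by positivity)).1 h2
  simpa [mul_pow, Real.sq_sqrt C.coe_nonneg] using h3

end lemmas

/-! ### The reduced C*-algebra -/

section reduced

variable {G : Type*} [TopologicalSpace G] [AlgGroupoid G] [EtaleGroupoid G]

/-- The regular representation `λ(f) ξ = f * ξ` of `C_c(G)` on `ℓ²(G) = ⨁_{x ∈ G⁽⁰⁾} ℓ²(G x)`,
the direct sum of the regular representations `π_x` on `ℓ²(G x)`. -/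
def regRep (f : C_c(G, ℂ)) : ℓ^2(G, ℂ) →L[ℂ] ℓ^2(G, ℂ) :=
  LinearMap.mkContinuousOfExistsBound
    { toFun := fun ξ => ⟨conv f ξ,
        memℓp_gen' ((exists_conv_bound_real f).choose_spec.2 ξ)⟩
      map_add' := fun ξ η => by
        ext g
        change conv f (fun x => ξ x + η x) g = conv f ξ g + conv f η g
        unfold conv
        rw [← (summable_conv f ξ g).tsum_add (summable_conv f η g)]
        exact tsum_congr fun h => mul_add _ _ _
      map_smul' := fun c ξ => by
        ext g
        change conv f (fun x => c * ξ x) g = c * conv f ξ g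
        unfold conv
        rw [← tsum_mul_left]
        exact tsum_congr fun h => mul_left_comm _ _ _ }
    (by
      obtain ⟨C, h0, hC⟩ := exists_conv_bound_real f
      exact ⟨C, fun ξ => lp.norm_le_of_forall_sum_le (by simp) (by positivity) (hC ξ)⟩)

@[simp]
theorem regRep_apply (f : C_c(G, ℂ)) (ξ : ℓ^2(G, ℂ)) (g : G) :
    regRep f ξ g = conv f ξ g := rfl

variable (G) in
/-- The reduced C*-algebra `C_r^*(G)`: the norm closure of the *-algebra `λ(C_c(G))`, i.e. the
completion of `C_c(G)` for the norm `‖f‖ = ‖λ(f)‖ = sup_{x ∈ G⁽⁰⁾} ‖π_x(f)‖`. (As `λ(C_c(G))` is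
already closed under the *-algebra operations, `adjoin` adds nothing to it; it only provides the
bundled structure.) -/
def reducedCStar : NonUnitalStarSubalgebra ℂ (ℓ^2(G, ℂ) →L[ℂ] ℓ^2(G, ℂ)) :=
  (NonUnitalStarAlgebra.adjoin ℂ (Set.range (regRep (G := G)))).topologicalClosure

/-- The canonical map `C_c(G) → C_r^*(G)`. -/
def toReduced (f : C_c(G, ℂ)) : reducedCStar G :=
  ⟨regRep f, NonUnitalStarSubalgebra.le_topologicalClosure _
    (NonUnitalStarAlgebra.subset_adjoin ℂ _ ⟨f, rfl⟩)⟩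

open Classical in
/-- The inclusion `C(G⁽⁰⁾) ⊆ C_c(G)` (extension by zero), for compact `G⁽⁰⁾`. -/
def ofUnits [CompactSpace (units G)] (q : C(units G, ℂ)) : C_c(G, ℂ) where
  toFun g := if hg : g ∈ units G then q ⟨g, hg⟩ else 0
  continuous_toFun := by
    rw [continuous_iff_continuousAt]
    intro g
    by_cases hg : g ∈ units G
    · have ho := (isClopen_units (G := G)).isOpen
      refine ContinuousOn.continuousAt (s := units G) ?_ (ho.mem_nhds hg)
      rw [continuousOn_iff_continuous_domRestrict]
      refine q.continuous.congr fun x => ?_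
      simp
    · have ho := (isClopen_units (G := G)).compl.isOpen
      refine (continuousAt_const (y := (0 : ℂ))).congr ?_
      filter_upwards [ho.mem_nhds hg] with y hy
      rw [dif_neg hy]
  hasCompactSupport' := by
    refine HasCompactSupport.intro (isCompact_iff_compactSpace.2 ‹_› : IsCompact (units G)) ?_
    intro g hg
    exact dif_neg hg

end reduced

/-- The characteristic function `χ_W ∈ C(X)` of a clopen set `W ⊆ X`. -/
def charFun {X : Type*} [TopologicalSpace X] (W : Set X) (hW : IsClopen W) : C(X, ℂ) :=
  ⟨W.indicator 1, continuous_const.indicator (by simp [hW.frontier_eq])⟩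

/-- Murray–von Neumann equivalence in a C*-algebra `A`. -/
def MvNEquiv {A : Type*} [Mul A] [Star A] (p q : A) : Prop :=
  ∃ v : A, p = v * star v ∧ q = star v * v

end AlgGroupoid

end

/-! Enclose the supports of `F` in a compact open set `C` closed under inversion, and let `N` bound
the number of arrows of `C` with a given range. Take an elementary `K` that is `(C,
1/(nN+1))`-invariant and let `W = s(C \ K)`, which is clopen. An arrow outside `K` where some `f ∈
F` is nonzero has its source in `W` and, since `C` is symmetric, its range too. Hence `f(1-p)` and
`(1-p)f` vanish off `K`.

The set `W` is small along `K`. If `k ∈ Kx` ends in `W`, some `c ∈ C \ K` is composable with it, and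
`ck` lies in `CKx \ Kx`. At most `N` arrows `k` give the same product, so `n` times the number of
arrows of `Kx` ending in `W` is at most `|Kx|` (`arrowCount_src_diff_le`).

Counting becomes comparison through maximal bisections. If `Kx` never has more arrows ending in `W`
than in `R`, a compact open bisection inside `K` that cannot be enlarged must carry all of `W` into
`R` (`exists_bisection_of_arrowCount_le`). Removing its range and repeating gives `n` disjoint
copies of `W`. The characteristic function of each bisection is a partial isometry implementing the
equivalence of projections. -/

namespace AlgGroupoid

/-! ### Units, subgroupoids and counting arrows -/

section algebra

variable {G : Type*} [AlgGroupoid G]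

theorem src_of_mem_units {u : G} (hu : u ∈ units G) : src u = u := by
  obtain ⟨g, rfl⟩ := hu
  exact src_rng g

theorem rng_of_mem_units {u : G} (hu : u ∈ units G) : rng u = u := (mem_units_iff u).1 hu

theorem rng_mem_units (g : G) : rng g ∈ units G := ⟨g, rfl⟩

theorem src_mem_units (g : G) : src g ∈ units G := ⟨src g, rng_src g⟩

theorem inv_of_mem_units {u : G} (hu : u ∈ units G) : u⁻¹ = u := by
  have h1 : src u⁻¹ = u := by rw [src_inv, rng_of_mem_units hu]
  have h2 := mul_src u⁻¹
  rwa [h1, inv_mul_self, src_of_mem_units hu, eq_comm] at h2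

theorem inv_mul_mul (h g : G) (e : src h = rng g) : h⁻¹ * (h * g) = g := by
  have := mul_inv_mul h⁻¹ g (by rw [rng_inv, e])
  rwa [inv_inv'] at this

theorem mul_mul_inv (g h : G) (e : src g = rng h) : g * h * h⁻¹ = g := by
  rw [mul_assoc' _ _ _ e (rng_inv h).symm, mul_inv_self, ← e, mul_src]

theorem eq_of_inv_mul_mem_units {g h : G} (e : rng h = rng g) (hu : h⁻¹ * g ∈ units G) :
    h = g := by
  have h1 : src h⁻¹ = rng g := by rw [src_inv, e]
  have h2 : h⁻¹ * g = src h := by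
    rw [← rng_of_mem_units hu, rng_mul _ _ h1, rng_inv]
  rw [← mul_inv_mul h g e, h2, mul_src]

/-- Contrapositively, an arrow outside `K` composed with an arrow of `K` stays outside `K`; this
places `ck` in `CKx \ Kx`. -/
theorem IsSubgroupoid.left_mem {K : Set G} (hK : IsSubgroupoid K) {g h : G} (e : src g = rng h)
    (hgh : g * h ∈ K) (hh : h ∈ K) : g ∈ K := by
  rw [← mul_mul_inv g h e]
  exact hK.mul_mem _ hgh _ (hK.inv_mem _ hh) (by rw [src_mul _ _ e, rng_inv])

theorem rng_image_inv_preimage (V : Set G) : rng '' ((fun g : G => g⁻¹) ⁻¹' V) = src '' V := by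
  ext x
  constructor
  · rintro ⟨g, hg, rfl⟩
    exact ⟨g⁻¹, hg, src_inv g⟩
  · rintro ⟨g, hg, rfl⟩
    exact ⟨g⁻¹, by simpa [inv_inv'] using hg, rng_inv g⟩

/-- The number of arrows of `K` from the unit `x` to the set `A`. -/
noncomputable def arrowCount (K : Set G) (x : G) (A : Set G) : ℕ :=
  (fiber K x ∩ rng ⁻¹' A).ncard

theorem arrowCount_units (K : Set G) (x : G) : arrowCount K x (units G) = (fiber K x).ncard := by
  unfold arrowCount
  congr 1
  exact Set.inter_eq_left.2 fun g _ => rng_mem_units g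

theorem arrowCount_diff_add {K : Set G} {x : G} (hf : (fiber K x).Finite) {A B : Set G}
    (h : B ⊆ A) : arrowCount K x (A \ B) + arrowCount K x B = arrowCount K x A := by
  unfold arrowCount
  rw [← Set.ncard_sdiff_add_ncard_of_subset
    (Set.inter_subset_inter_right (fiber K x) (Set.preimage_mono h))
    (hf.subset Set.inter_subset_left)]
  congr 2
  ext g
  simp only [Set.mem_inter_iff, Set.mem_preimage, Set.mem_sdiff]
  tauto

/-- Translation by a bisection contained in `K` preserves the number of arrows. -/
theorem arrowCount_rng_eq_src {K : Set G} (hK : IsSubgroupoid K) {V : Set G} (hV : V ⊆ K)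
    (hs : Set.InjOn src V) (hr : Set.InjOn rng V) (x : G) :
    arrowCount K x (rng '' V) = arrowCount K x (src '' V) := by
  classical
  have ex : ∀ k ∈ fiber K x ∩ rng ⁻¹' (src '' V), ∃ v ∈ V, src v = rng k := fun k hk => hk.2
  choose! v hv using ex
  symm
  -- Left translation by the arrow of `V` starting where `k` ends; its inverse is translation by
  -- `V⁻¹`.
  refine Set.ncard_congr (fun k _ => v k * k) ?_ ?_ ?_
  · intro k hk
    obtain ⟨h1, h2⟩ := hv k hk
    exact ⟨⟨hK.mul_mem _ (hV h1) _ hk.1.1 h2, (src_mul _ _ h2).trans hk.1.2⟩,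
      v k, h1, (rng_mul _ _ h2).symm⟩
  · intro k l hk hl e
    obtain ⟨h1, h2⟩ := hv k hk
    obtain ⟨h3, h4⟩ := hv l hl
    have e1 : v k = v l := hr h1 h3 (by rw [← rng_mul _ _ h2, ← rng_mul _ _ h4]; exact congrArg _ e)
    rw [← inv_mul_mul _ _ h2, ← inv_mul_mul _ _ h4]
    rw [e, e1]
  · rintro g ⟨⟨hg, hgx⟩, w, hw, hwg⟩
    have e0 : src w⁻¹ = rng g := by rw [src_inv, hwg]
    have e1 : rng (w⁻¹ * g) = src w := by rw [rng_mul _ _ e0, rng_inv]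
    have hm : w⁻¹ * g ∈ fiber K x ∩ rng ⁻¹' (src '' V) :=
      ⟨⟨hK.mul_mem _ (hK.inv_mem _ (hV hw)) _ hg e0, (src_mul _ _ e0).trans hgx⟩, w, hw, e1.symm⟩
    refine ⟨w⁻¹ * g, hm, ?_⟩
    obtain ⟨h1, h2⟩ := hv _ hm
    have : v (w⁻¹ * g) = w := hs h1 hw (h2.trans e1)
    rw [this, mul_inv_mul _ _ hwg]

end algebra

/-! ### Compact open sets and bisections -/

section topology

variable {G : Type*} [TopologicalSpace G] [AlgGroupoid G]

section etale

variable [EtaleGroupoid G]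

theorem isOpenMap_rng : IsOpenMap (rng : G → G) :=
  (EtaleGroupoid.isLocalHomeomorph_rng (G := G)).isOpenMap

variable (G) in
/-- Inversion as a homeomorphism. -/
def invHomeomorph : G ≃ₜ G where
  toFun g := g⁻¹
  invFun g := g⁻¹
  left_inv := inv_inv'
  right_inv := inv_inv'
  continuous_toFun := EtaleGroupoid.continuous_inv'
  continuous_invFun := EtaleGroupoid.continuous_inv'

theorem isOpenMap_src : IsOpenMap (src : G → G) := by
  have h : (src : G → G) = rng ∘ invHomeomorph G := funext fun g => (rng_inv g).symm
  rw [h]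
  exact isOpenMap_rng.comp (invHomeomorph G).isOpenMap

theorem isClopen_src_image {S : Set G} (hc : IsCompact S) (ho : IsOpen S) :
    IsClopen (src '' S) :=
  ⟨(hc.image EtaleGroupoid.continuous_src).isClosed, isOpenMap_src _ ho⟩

theorem isClopen_rng_image {S : Set G} (hc : IsCompact S) (ho : IsOpen S) :
    IsClopen (rng '' S) :=
  ⟨(hc.image EtaleGroupoid.continuous_rng).isClosed, isOpenMap_rng _ ho⟩

theorem finite_fiber {K : Set G} (hK : IsCompact K) (x : G) : (fiber K x).Finite := by
  obtain ⟨N, hN⟩ := fiber_bound (locInj_src (G := G)) hK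
  exact Set.finite_of_encard_le_coe (hN x)

/-- Compact open bisections. -/
structure IsCompactOpenBisection (V : Set G) : Prop where
  isCompact : IsCompact V
  isOpen : IsOpen V
  injOn_src : Set.InjOn src V
  injOn_rng : Set.InjOn rng V

theorem IsCompactOpenBisection.inv {V : Set G} (hV : IsCompactOpenBisection V) :
    IsCompactOpenBisection ((fun g : G => g⁻¹) ⁻¹' V) where
  isCompact := (invHomeomorph G).isCompact_preimage.2 hV.isCompact
  isOpen := hV.isOpen.preimage EtaleGroupoid.continuous_inv'
  injOn_src g hg h hh e := by
    rw [← rng_inv, ← rng_inv] at e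
    exact (invHomeomorph G).injective (hV.injOn_rng hg hh e)
  injOn_rng g hg h hh e := by
    rw [← src_inv, ← src_inv] at e
    exact (invHomeomorph G).injective (hV.injOn_src hg hh e)

/-- If `W` consists of sources of arrows in `C \ K`, the arrows of `Kx` ending in `W` are
controlled by `CKx \ Kx`. -/
theorem arrowCount_src_diff_le {C K : Set G} (hC : IsCompact C) (hK : IsSubgroupoid K)
    (hKc : IsCompact K) {N : ℕ} (hN : ∀ x, (C ∩ rng ⁻¹' {x}).encard ≤ N) (x : G) :
    arrowCount K x (src '' (C \ K)) ≤ N * (setMul C (fiber K x) \ fiber K x).ncard := by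
  classical
  have hf := finite_fiber hKc x
  -- Finiteness matters because `ncard` of an infinite set is `0`.
  have hT : (setMul C (fiber K x)).Finite := by
    refine (hf.biUnion (t := fun k => (fun c => c * k) '' (fiber C (rng k)))
      fun k _ => (finite_fiber hC (rng k)).image _).subset ?_
    rintro g ⟨c, hc, k, hk, e, rfl⟩
    exact Set.mem_biUnion hk ⟨c, ⟨hc, e⟩, rfl⟩
  have hT' := hT.subset (Set.sdiff_subset (t := fiber K x))
  have hS : (fiber K x ∩ rng ⁻¹' (src '' (C \ K))).Finite := hf.subset Set.inter_subset_left
  have ex : ∀ k ∈ fiber K x ∩ rng ⁻¹' (src '' (C \ K)), ∃ c ∈ C \ K, src c = rng k :=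
    fun k hk => hk.2
  choose! c hc using ex
  unfold arrowCount
  rw [Set.ncard_eq_toFinset_card _ hS, Set.ncard_eq_toFinset_card _ hT']
  refine Finset.card_le_mul_card_image_of_maps_to (f := fun k => c k * k) ?_ N ?_
  · intro k hk
    rw [Set.Finite.mem_toFinset] at hk ⊢
    obtain ⟨h1, h2⟩ := hc k hk
    exact ⟨⟨c k, h1.1, k, hk.1, h2, rfl⟩, fun h3 => h1.2 (hK.left_mem h2 h3.1 hk.1.1)⟩
  -- If `c k * k = g`, then `c k` has the range of `g` and determines `k` as `(c k)⁻¹ * g`, so at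
  -- most `N` arrows `k` lie over `g`.
  · intro g _
    have hfin : (C ∩ rng ⁻¹' {rng g}).Finite := Set.finite_of_encard_le_coe (hN _)
    have hcard := hN (rng g)
    rw [hfin.encard_eq_coe_toFinset_card, Nat.cast_le] at hcard
    refine le_trans (Finset.card_le_card_of_injOn c ?_ ?_) hcard
    · intro k hk
      simp only [Finset.coe_filter, Set.Finite.mem_toFinset, Set.mem_ofPred_eq] at hk
      obtain ⟨h1, h2⟩ := hc k hk.1
      simp only [Set.Finite.coe_toFinset]
      exact ⟨h1.1, by rw [Set.mem_preimage, Set.mem_singleton_iff, ← hk.2, rng_mul _ _ h2]⟩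
    · intro k hk l hl e
      simp only [Finset.coe_filter, Set.Finite.mem_toFinset, Set.mem_ofPred_eq] at hk hl
      rw [← inv_mul_mul _ _ (hc k hk.1).2, ← inv_mul_mul _ _ (hc l hl.1).2, hk.2, hl.2, e]

end etale

/-! ### Comparison by bisections inside an elementary subgroupoid -/

section ample

variable [AmpleGroupoid G] [CompactSpace (units G)]

/-- Lift a small clopen set of units around `rng g` through a local inverse of `rng`, keeping the
lift inside a neighbourhood of `g` where `src` is injective. -/
theorem exists_compactOpenBisection {O : Set G} (hO : IsOpen O) {g : G} (hg : g ∈ O) :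
    ∃ B, IsCompactOpenBisection B ∧ g ∈ B ∧ B ⊆ O := by
  obtain ⟨U, hU, hi⟩ := isLocallyInjective_iff_nhds.1 (locInj_src (G := G)) g
  obtain ⟨e, hge, he⟩ := EtaleGroupoid.isLocalHomeomorph_rng (G := G) g
  have hO' : IsOpen (e '' (e.source ∩ (O ∩ interior U))) :=
    e.isOpen_image_source_inter (hO.inter isOpen_interior)
  have : TotallyDisconnectedSpace (units G) :=
    totallyDisconnectedSpace_subtype_iff.2 AmpleGroupoid.totallyDisconnected_units
  obtain ⟨D, hD, hgD, hDs⟩ := compact_exists_isClopen_in_isOpen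
    (hO'.preimage (continuous_subtype_val (p := (· ∈ units G)))) (x := ⟨rng g, rng_mem_units g⟩)
    ⟨g, ⟨hge, hg, mem_interior_iff_mem_nhds.2 hU⟩, (congrFun he g).symm⟩
  set D' : Set G := Subtype.val '' D with hD'
  have hDc : IsCompact D' := hD.isClosed.isCompact.image continuous_subtype_val
  have hDo : IsOpen D' := isClopen_units.isOpen.isOpenMap_subtype_val _ hD.isOpen
  have hDsub : D' ⊆ e '' (e.source ∩ (O ∩ interior U)) := by
    rintro _ ⟨y, hy, rfl⟩
    exact hDs hy
  have hDt : D' ⊆ e.target := by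
    intro y hy
    obtain ⟨z, hz, rfl⟩ := hDsub hy
    exact e.map_source hz.1
  have hB : e.symm '' D' ⊆ e.source ∩ (O ∩ interior U) := by
    rintro _ ⟨y, hy, rfl⟩
    obtain ⟨z, hz, rfl⟩ := hDsub hy
    rwa [e.left_inv hz.1]
  refine ⟨e.symm '' D', ⟨hDc.image_of_continuousOn (e.continuousOn_symm.mono hDt), ?_, ?_, ?_⟩,
    ?_, fun y hy => (hB hy).2.1⟩
  · rw [← e.isOpen_symm_image_iff_of_subset_target hDt] at hDo
    exact hDo
  · exact hi.mono fun y hy => interior_subset (hB hy).2.2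
  · rw [he]
    exact e.injOn.mono fun y hy => (hB hy).1
  · refine ⟨rng g, ⟨_, hgD, rfl⟩, ?_⟩
    rw [he, e.left_inv hge]

theorem exists_compact_open_superset {S : Set G} (hS : IsCompact S) :
    ∃ C, IsCompact C ∧ IsOpen C ∧ S ⊆ C := by
  refine hS.induction_on (p := fun S => ∃ C, IsCompact C ∧ IsOpen C ∧ S ⊆ C) ?_ ?_ ?_ ?_
  · exact ⟨∅, isCompact_empty, isOpen_empty, le_rfl⟩
  · rintro s t hst ⟨C, h1, h2, h3⟩
    exact ⟨C, h1, h2, hst.trans h3⟩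
  · rintro s t ⟨C, h1, h2, h3⟩ ⟨D, h4, h5, h6⟩
    exact ⟨C ∪ D, h1.union h4, h2.union h5, Set.union_subset_union h3 h6⟩
  · intro g _
    obtain ⟨B, hB, hg, _⟩ := exists_compactOpenBisection isOpen_univ (Set.mem_univ g)
    exact ⟨B, mem_nhdsWithin_of_mem_nhds (hB.isOpen.mem_nhds hg), B, hB.isCompact, hB.isOpen,
      le_rfl⟩

/-- A bisection in `K` from `W` to `R` which cannot be enlarged by arrows of `S`. -/
theorem exists_maximal_bisection {K : Set G} (hKo : IsOpen K) {W R : Set G} (hW : IsClopen W)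
    (hR : IsClopen R) {S : Set G} (hS : IsCompact S) (hSK : S ⊆ K) :
    ∃ V, IsCompactOpenBisection V ∧ V ⊆ K ∧ src '' V ⊆ W ∧ rng '' V ⊆ R ∧
      ∀ b ∈ S, src b ∈ W → rng b ∈ R → src b ∈ src '' V ∨ rng b ∈ rng '' V := by
  let good : Set G → Prop := fun V =>
    IsCompactOpenBisection V ∧ V ⊆ K ∧ src '' V ⊆ W ∧ rng '' V ⊆ R
  -- Extending an arbitrary `V₀` lets the union case of the compactness induction run the two
  -- extensions in succession; maximality persists because the source and range sets only grow.
  suffices h : ∀ V₀, good V₀ → ∃ V, V₀ ⊆ V ∧ good V ∧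
      ∀ b ∈ S, src b ∈ W → rng b ∈ R → src b ∈ src '' V ∨ rng b ∈ rng '' V by
    obtain ⟨V, -, ⟨h1, h2, h3, h4⟩, h5⟩ := h ∅
      ⟨⟨isCompact_empty, isOpen_empty, Set.injOn_empty _, Set.injOn_empty _⟩, by simp⟩
    exact ⟨V, h1, h2, h3, h4, h5⟩
  refine hS.induction_on (p := fun S => ∀ V₀, good V₀ → ∃ V, V₀ ⊆ V ∧ good V ∧
      ∀ b ∈ S, src b ∈ W → rng b ∈ R → src b ∈ src '' V ∨ rng b ∈ rng '' V) ?_ ?_ ?_ ?_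
  · exact fun V h => ⟨V, le_rfl, h, by simp⟩
  · intro s t hst ht V₀ h0
    obtain ⟨V, h1, h2, h3⟩ := ht V₀ h0
    exact ⟨V, h1, h2, fun b hb => h3 b (hst hb)⟩
  · intro s t hs ht V₀ h0
    obtain ⟨V, h1, h2, h3⟩ := hs V₀ h0
    obtain ⟨V', h4, h5, h6⟩ := ht V h2
    refine ⟨V', h1.trans h4, h5, ?_⟩
    rintro b (hb | hb) hbW hbR
    · exact (h3 b hb hbW hbR).imp (fun h => Set.image_mono h4 h) (fun h => Set.image_mono h4 h)
    · exact h6 b hb hbW hbR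
  · intro g hg
    obtain ⟨B, hB, hgB, hBK⟩ := exists_compactOpenBisection hKo (hSK hg)
    refine ⟨B, mem_nhdsWithin_of_mem_nhds (hB.isOpen.mem_nhds hgB), ?_⟩
    rintro V ⟨hV, hVK, hVW, hVR⟩
    have c1 : IsClopen (src ⁻¹' (W \ src '' V)) :=
      (hW.diff (isClopen_src_image hV.isCompact hV.isOpen)).preimage EtaleGroupoid.continuous_src
    have c2 : IsClopen (rng ⁻¹' (R \ rng '' V)) :=
      (hR.diff (isClopen_rng_image hV.isCompact hV.isOpen)).preimage EtaleGroupoid.continuous_rng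
    have c := c1.inter c2
    -- All arrows of `B` whose source and range are both still free; adding them keeps `V` a
    -- bisection.
    set A := B ∩ (src ⁻¹' (W \ src '' V) ∩ rng ⁻¹' (R \ rng '' V)) with hA
    have hdisj : Disjoint V A :=
      Set.disjoint_left.2 fun y hy hy' => hy'.2.1.2 ⟨y, hy, rfl⟩
    refine ⟨V ∪ A, Set.subset_union_left, ⟨⟨hV.isCompact.union (hB.isCompact.inter_right c.isClosed),
      hV.isOpen.union (hB.isOpen.inter c.isOpen), ?_, ?_⟩, ?_, ?_, ?_⟩, ?_⟩
    · rw [Set.injOn_union hdisj]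
      exact ⟨hV.injOn_src, hB.injOn_src.mono Set.inter_subset_left,
        fun a ha b hb e => hb.2.1.2 ⟨a, ha, e⟩⟩
    · rw [Set.injOn_union hdisj]
      exact ⟨hV.injOn_rng, hB.injOn_rng.mono Set.inter_subset_left,
        fun a ha b hb e => hb.2.2.2 ⟨a, ha, e⟩⟩
    · exact Set.union_subset hVK (Set.inter_subset_left.trans hBK)
    · rw [Set.image_union]
      refine Set.union_subset hVW ?_
      rintro _ ⟨y, hy, rfl⟩
      exact hy.2.1.1
    · rw [Set.image_union]
      refine Set.union_subset hVR ?_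
      rintro _ ⟨y, hy, rfl⟩
      exact hy.2.2.1
    · intro b hb hbW hbR
      by_contra! hcon
      rw [Set.image_union, Set.image_union] at hcon
      exact hcon.1 (Or.inr ⟨b, ⟨hb, ⟨hbW, fun h => hcon.1 (Or.inl h)⟩,
        ⟨hbR, fun h => hcon.2 (Or.inl h)⟩⟩, rfl⟩)

/-- Comparison: if every orbit of `K` meets `R` at least as often as `W`, then `W` can be moved
into `R` by a compact open bisection in `K`. -/
theorem exists_bisection_of_arrowCount_le {K : Set G} (hK : IsElementary K) {W R : Set G}
    (hW : IsClopen W) (hWu : W ⊆ units G) (hR : IsClopen R)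
    (h : ∀ x ∈ units G, arrowCount K x W ≤ arrowCount K x R) :
    ∃ V, IsCompactOpenBisection V ∧ V ⊆ K ∧ src '' V = W ∧ rng '' V ⊆ R := by
  obtain ⟨V, hV, hVK, hVW, hVR, hmax⟩ :=
    exists_maximal_bisection hK.isOpen hW hR hK.isCompact le_rfl
  refine ⟨V, hV, hVK, hVW.antisymm fun w hw => ?_, hVR⟩
  by_contra hwV
  have hu := hWu hw
  have hf := finite_fiber hK.isCompact w
  -- Since `w` is missed by `src '' V`, maximality forces every arrow of `K` from `w` into `R` to
  -- end in `rng '' V`.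
  have h1 : arrowCount K w R ≤ arrowCount K w (rng '' V) := by
    refine Set.ncard_le_ncard ?_ (hf.subset Set.inter_subset_left)
    rintro k ⟨hk, hkR⟩
    refine ⟨hk, (hmax k hk.1 (by rwa [hk.2]) hkR).resolve_left ?_⟩
    rwa [hk.2]
  -- Strict because the unit `w` itself is counted on the right only.
  have h2 : arrowCount K w (src '' V) < arrowCount K w W := by
    refine Set.ncard_lt_ncard ⟨Set.inter_subset_inter_right _ (Set.preimage_mono hVW), fun hsub => ?_⟩
      (hf.subset Set.inter_subset_left)
    have hwK : w ∈ K := Set.inter_eq_right.1 hK.units_eq hu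
    have := (hsub ⟨⟨hwK, src_of_mem_units hu⟩, by rwa [Set.mem_preimage, rng_of_mem_units hu]⟩).2
    rw [Set.mem_preimage, rng_of_mem_units hu] at this
    exact hwV this
  rw [arrowCount_rng_eq_src hK.isSubgroupoid hVK hV.injOn_src hV.injOn_rng] at h1
  exact absurd (h w hu) (by omega)

/-- Each range removed from `R` costs exactly `arrowCount K x W`, by translation invariance, so the
hypothesis for `n + 1` leaves that for `n` on the remainder. -/
theorem exists_disjoint_bisections {K : Set G} (hK : IsElementary K) {W : Set G}
    (hW : IsClopen W) (hWu : W ⊆ units G) (n : ℕ) {R : Set G} (hR : IsClopen R)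
    (h : ∀ x ∈ units G, n * arrowCount K x W ≤ arrowCount K x R) :
    ∃ V : Fin n → Set G, (∀ i, IsCompactOpenBisection (V i) ∧ src '' V i = W ∧ rng '' V i ⊆ R) ∧
      Pairwise fun i j => Disjoint (rng '' V i) (rng '' V j) := by
  induction n generalizing R with
  | zero => exact ⟨fun _ => ∅, fun i => i.elim0, fun i => i.elim0⟩
  | succ n ih =>
    obtain ⟨V, hV, hVK, hVW, hVR⟩ := exists_bisection_of_arrowCount_le hK hW hWu hR
      fun x hx => (Nat.le_mul_of_pos_left _ n.succ_pos).trans (h x hx)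
    have hVc := isClopen_rng_image hV.isCompact hV.isOpen
    obtain ⟨V', h1, h2⟩ := ih (hR.diff hVc) fun x hx => by
      have a := arrowCount_diff_add (finite_fiber hK.isCompact x) hVR
      have b := arrowCount_rng_eq_src hK.isSubgroupoid hVK hV.injOn_src hV.injOn_rng x
      have c := h x hx
      rw [hVW] at b
      rw [add_mul, one_mul] at c
      omega
    have hd : ∀ i, Disjoint (rng '' V) (rng '' V' i) := fun i =>
      Set.disjoint_left.2 fun y hy hy' => ((h1 i).2.2 hy').2 hy
    refine ⟨Fin.cons V V', ?_, ?_⟩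
    · refine Fin.cases ⟨hV, hVW, hVR⟩ fun i => ?_
      exact ⟨(h1 i).1, (h1 i).2.1, (h1 i).2.2.trans Set.sdiff_subset⟩
    · intro i j
      refine Fin.cases ?_ (fun i => ?_) i <;> refine Fin.cases ?_ (fun j => ?_) j
      · exact fun h => absurd rfl h
      · exact fun _ => hd j
      · exact fun _ => (hd i).symm
      · exact fun hij => h2 fun e => hij (congrArg Fin.succ e)

end ample

end topology

end AlgGroupoid

/-! ### Bisections as partial isometries in the reduced C*-algebra -/

namespace AlgGroupoid

section operators

variable {G : Type*} [TopologicalSpace G] [AlgGroupoid G] [EtaleGroupoid G]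

/-- The characteristic function of a compact open set of arrows. -/
noncomputable def indicatorCc (V : Set G) (hc : IsCompact V) (ho : IsOpen V) : C_c(G, ℂ) where
  toFun := V.indicator 1
  continuous_toFun := continuous_const.indicator
    (by simp [IsClopen.frontier_eq ⟨hc.isClosed, ho⟩])
  hasCompactSupport' := HasCompactSupport.intro hc fun _ hx => Set.indicator_of_notMem hx _

theorem conv_indicatorCc_of_mem {V : Set G} (hV : IsCompactOpenBisection V) (ξ : G → ℂ) {g h : G}
    (hh : h ∈ V) (e : rng h = rng g) :
    conv (indicatorCc V hV.isCompact hV.isOpen) ξ g = ξ (h⁻¹ * g) := by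
  unfold conv
  rw [tsum_eq_single ⟨h, e⟩]
  · change V.indicator 1 h * _ = _
    rw [Set.indicator_of_mem hh, Pi.one_apply, one_mul]
  · rintro ⟨k, hk⟩ hne
    change V.indicator 1 k * _ = _
    rw [Set.indicator_of_notMem, zero_mul]
    exact fun hkV => hne (Subtype.ext (hV.injOn_rng hkV hh (hk.trans e.symm)))

theorem conv_indicatorCc_of_notMem {V : Set G} (hV : IsCompactOpenBisection V) (ξ : G → ℂ) {g : G}
    (hg : rng g ∉ rng '' V) : conv (indicatorCc V hV.isCompact hV.isOpen) ξ g = 0 := by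
  unfold conv
  rw [← tsum_zero]
  refine tsum_congr ?_
  rintro ⟨k, hk⟩
  change V.indicator 1 k * _ = _
  rw [Set.indicator_of_notMem, zero_mul]
  exact fun hkV => hg ⟨k, hkV, hk⟩

theorem conv_indicatorCc_inv_of_mem {V : Set G} (hV : IsCompactOpenBisection V) (ξ : G → ℂ)
    {g h : G} (hh : h ∈ V) (e : src h = rng g) :
    conv (indicatorCc _ hV.inv.isCompact hV.inv.isOpen) ξ g = ξ (h * g) := by
  rw [conv_indicatorCc_of_mem hV.inv ξ (h := h⁻¹) (by simpa [inv_inv'] using hh)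
    ((rng_inv h).trans e), inv_inv']

theorem conv_indicatorCc_inv_of_notMem {V : Set G} (hV : IsCompactOpenBisection V) (ξ : G → ℂ)
    {g : G} (hg : rng g ∉ src '' V) :
    conv (indicatorCc _ hV.inv.isCompact hV.inv.isOpen) ξ g = 0 :=
  conv_indicatorCc_of_notMem hV.inv ξ (by rwa [rng_image_inv_preimage])

/-- Translation `g ↦ v g * g` maps arrows ending in `src '' V` bijectively to those ending in `rng
'' V`; reindexing by it turns one sum into the other. -/
theorem tsum_inner_conv_indicatorCc_inv {V : Set G} (hV : IsCompactOpenBisection V)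
    (ξ η : G → ℂ) :
    ∑' g, inner ℂ (conv (indicatorCc _ hV.inv.isCompact hV.inv.isOpen) ξ g) (η g) =
      ∑' g, inner ℂ (ξ g) (conv (indicatorCc V hV.isCompact hV.isOpen) η g) := by
  classical
  have ex : ∀ g : G, rng g ∈ src '' V → ∃ v ∈ V, src v = rng g := fun g hg => hg
  choose! v hv using ex
  set P : G → ℂ := fun g => inner ℂ (conv (indicatorCc _ hV.inv.isCompact hV.inv.isOpen) ξ g) (η g)
    with hP
  have hsupp : ∀ g ∈ Function.support P, rng g ∈ src '' V := by
    intro g hg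
    by_contra hn
    exact hg (by simp only [hP]; rw [conv_indicatorCc_inv_of_notMem hV _ hn, inner_zero_left])
  symm
  refine tsum_eq_tsum_of_ne_zero_bij (fun g => v g * g) ?_ ?_ ?_
  · rintro ⟨g, hg⟩ ⟨h, hh⟩ e
    obtain ⟨a1, a2⟩ := hv g (hsupp g hg)
    obtain ⟨b1, b2⟩ := hv h (hsupp h hh)
    dsimp only at e
    have e1 : v g = v h := hV.injOn_rng a1 b1 (by rw [← rng_mul _ _ a2, ← rng_mul _ _ b2, e])
    rw [Subtype.mk.injEq, ← inv_mul_mul _ _ a2, ← inv_mul_mul _ _ b2, e, e1]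
  · intro g hg
    by_cases hr : rng g ∈ rng '' V
    · obtain ⟨h, hh, e⟩ := hr
      have e0 : src h⁻¹ = rng g := by rw [src_inv, e]
      have e1 : rng (h⁻¹ * g) = src h := by rw [rng_mul _ _ e0, rng_inv]
      obtain ⟨a1, a2⟩ := hv (h⁻¹ * g) ⟨h, hh, e1.symm⟩
      have e2 : v (h⁻¹ * g) = h := hV.injOn_src a1 hh (a2.trans e1)
      refine ⟨⟨h⁻¹ * g, ?_⟩, ?_⟩
      · rw [Function.mem_support] at hg ⊢
        rw [conv_indicatorCc_of_mem hV _ hh e] at hg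
        rwa [conv_indicatorCc_inv_of_mem hV _ hh e1.symm, mul_inv_mul _ _ e]
      · dsimp only
        rw [e2, mul_inv_mul _ _ e]
    · exact absurd (by dsimp only; rw [conv_indicatorCc_of_notMem hV _ hr, inner_zero_right]) hg
  · rintro ⟨g, hg⟩
    obtain ⟨a1, a2⟩ := hv g (hsupp g hg)
    dsimp only
    rw [conv_indicatorCc_inv_of_mem hV _ a1 a2,
      conv_indicatorCc_of_mem hV _ a1 (rng_mul _ _ a2).symm, inv_mul_mul _ _ a2]

/-- The adjoint of the partial isometry of a bisection is that of the inverse bisection. -/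
theorem star_regRep_indicatorCc {V : Set G} (hV : IsCompactOpenBisection V) :
    star (regRep (indicatorCc V hV.isCompact hV.isOpen)) =
      regRep (indicatorCc _ hV.inv.isCompact hV.inv.isOpen) := by
  rw [ContinuousLinearMap.star_eq_adjoint, eq_comm, ContinuousLinearMap.eq_adjoint_iff]
  intro ξ η
  rw [lp.inner_eq_tsum, lp.inner_eq_tsum]
  exact tsum_inner_conv_indicatorCc_inv hV ξ η

variable [CompactSpace (units G)]

theorem ofUnits_of_mem (q : C(units G, ℂ)) {g : G} (hg : g ∈ units G) :
    ofUnits q g = q ⟨g, hg⟩ := dif_pos hg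

theorem ofUnits_of_notMem (q : C(units G, ℂ)) {g : G} (hg : g ∉ units G) :
    ofUnits q g = 0 := dif_neg hg

theorem conv_ofUnits_left (q : C(units G, ℂ)) (ξ : G → ℂ) (g : G) :
    conv (ofUnits q) ξ g = q ⟨rng g, rng_mem_units g⟩ * ξ g := by
  unfold conv
  rw [tsum_eq_single ⟨rng g, rng_rng g⟩]
  · dsimp only
    rw [ofUnits_of_mem _ (rng_mem_units g), inv_of_mem_units (rng_mem_units g), rng_mul_self]
  · rintro ⟨k, hk⟩ hne
    dsimp only
    rw [ofUnits_of_notMem, zero_mul]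
    exact fun hu => hne (Subtype.ext ((rng_of_mem_units hu).symm.trans hk))

theorem conv_ofUnits_right (q : C(units G, ℂ)) (f : G → ℂ) (g : G) :
    conv f (ofUnits q) g = f g * q ⟨src g, src_mem_units g⟩ := by
  unfold conv
  rw [tsum_eq_single ⟨g, rfl⟩]
  · dsimp only
    rw [inv_mul_self, ofUnits_of_mem _ (src_mem_units g)]
  · rintro ⟨k, hk⟩ hne
    dsimp only
    rw [ofUnits_of_notMem, mul_zero]
    exact fun hu => hne (Subtype.ext (eq_of_inv_mul_mem_units hk hu))

theorem charFun_of_mem {X : Type*} [TopologicalSpace X] {W : Set X} (hW : IsClopen W) {x : X}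
    (hx : x ∈ W) : charFun W hW x = 1 := Set.indicator_of_mem hx _

theorem charFun_of_notMem {X : Type*} [TopologicalSpace X] {W : Set X} (hW : IsClopen W) {x : X}
    (hx : x ∉ W) : charFun W hW x = 0 := Set.indicator_of_notMem hx _

theorem isStarProjection_charFun {X : Type*} [TopologicalSpace X] {W : Set X} (hW : IsClopen W) :
    IsStarProjection (charFun W hW) := by
  constructor
  · ext x
    by_cases hx : x ∈ W <;> simp [charFun_of_mem, charFun_of_notMem, hx]
  · ext x
    by_cases hx : x ∈ W <;> simp [charFun_of_mem, charFun_of_notMem, hx]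

theorem charFun_mul_charFun_of_disjoint {X : Type*} [TopologicalSpace X] {W W' : Set X}
    (hW : IsClopen W) (hW' : IsClopen W') (h : Disjoint W W') :
    charFun W hW * charFun W' hW' = 0 := by
  ext x
  by_cases hx : x ∈ W
  · simp [charFun_of_notMem hW' (Set.disjoint_left.1 h hx)]
  · simp [charFun_of_notMem hW hx]

/-- The range projection of the partial isometry of a compact open bisection. -/
theorem regRep_indicatorCc_mul_star {V : Set G} (hV : IsCompactOpenBisection V)
    {W : Set (units G)} (hW : IsClopen W) (hVW : ∀ x : units G, x ∈ W ↔ (x : G) ∈ rng '' V) :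
    regRep (indicatorCc V hV.isCompact hV.isOpen) *
      star (regRep (indicatorCc V hV.isCompact hV.isOpen)) = regRep (ofUnits (charFun W hW)) := by
  rw [star_regRep_indicatorCc hV]
  ext ξ g
  rw [mul_apply_eq_comp, regRep_apply, regRep_apply, conv_ofUnits_left]
  by_cases hg : rng g ∈ rng '' V
  · rw [charFun_of_mem hW ((hVW _).2 hg), one_mul]
    obtain ⟨h, hh, e⟩ := hg
    have e0 : src h⁻¹ = rng g := by rw [src_inv, e]
    have e1 : src h = rng (h⁻¹ * g) := by rw [rng_mul _ _ e0, rng_inv]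
    rw [conv_indicatorCc_of_mem hV _ hh e, regRep_apply, conv_indicatorCc_inv_of_mem hV _ hh e1,
      mul_inv_mul _ _ e]
  · rw [charFun_of_notMem hW (mt (hVW _).1 hg), zero_mul, conv_indicatorCc_of_notMem hV _ hg]

/-- The source projection of the partial isometry of a compact open bisection. -/
theorem star_mul_regRep_indicatorCc {V : Set G} (hV : IsCompactOpenBisection V)
    {W : Set (units G)} (hW : IsClopen W) (hVW : ∀ x : units G, x ∈ W ↔ (x : G) ∈ src '' V) :
    star (regRep (indicatorCc V hV.isCompact hV.isOpen)) *
      regRep (indicatorCc V hV.isCompact hV.isOpen) = regRep (ofUnits (charFun W hW)) := by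
  have h := regRep_indicatorCc_mul_star hV.inv hW (by rwa [rng_image_inv_preimage])
  rwa [← star_regRep_indicatorCc hV, star_star] at h

theorem mvNEquiv_of_bisection {V : Set G} (hV : IsCompactOpenBisection V)
    {W W' : Set (units G)} (hW : IsClopen W) (hW' : IsClopen W')
    (hs : ∀ x : units G, x ∈ W ↔ (x : G) ∈ src '' V)
    (hr : ∀ x : units G, x ∈ W' ↔ (x : G) ∈ rng '' V) :
    MvNEquiv (toReduced (ofUnits (charFun W' hW'))) (toReduced (ofUnits (charFun W hW))) :=
  ⟨toReduced (indicatorCc V hV.isCompact hV.isOpen),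
    Subtype.ext (regRep_indicatorCc_mul_star hV hW' hr).symm,
    Subtype.ext (star_mul_regRep_indicatorCc hV hW hs).symm⟩

/-- Right convolution by `q` is pointwise multiplication by `q ∘ src`, and as `K` is closed,
vanishing off `K` already bounds the topological support. -/
theorem conv_ofUnits_right_mem_CcOn {K : Set G} (hK : IsClosed K) (f : C_c(G, ℂ))
    (q : C(units G, ℂ)) (h : ∀ g ∉ K, f g ≠ 0 → q ⟨src g, src_mem_units g⟩ = 0) :
    conv f (ofUnits q) ∈ CcOn K := by
  rw [show conv f (ofUnits q) = f * fun g => q ⟨src g, src_mem_units g⟩ from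
    funext (conv_ofUnits_right q f)]
  refine ⟨f.continuous.mul (q.continuous.comp (EtaleGroupoid.continuous_src.subtype_mk _)),
    f.hasCompactSupport.mul_right, closure_minimal (fun g hg => ?_) hK⟩
  by_contra hgK
  refine hg ?_
  by_cases hf : f g = 0
  · simp [hf]
  · simp [h g hgK hf]

theorem conv_ofUnits_left_mem_CcOn {K : Set G} (hK : IsClosed K) (f : C_c(G, ℂ))
    (q : C(units G, ℂ)) (h : ∀ g ∉ K, f g ≠ 0 → q ⟨rng g, rng_mem_units g⟩ = 0) :
    conv (ofUnits q) f ∈ CcOn K := by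
  rw [show conv (ofUnits q) f = (fun g => q ⟨rng g, rng_mem_units g⟩) * f from
    funext (conv_ofUnits_left q f)]
  refine ⟨(q.continuous.comp (EtaleGroupoid.continuous_rng.subtype_mk _)).mul f.continuous,
    f.hasCompactSupport.mul_left, closure_minimal (fun g hg => ?_) hK⟩
  by_contra hgK
  refine hg ?_
  by_cases hf : f g = 0
  · simp [hf]
  · simp [h g hgK hf]

end operators

end AlgGroupoid

/-! ### The main theorem -/

open AlgGroupoid in
theorem mainTheorem7 {G : Type*} [TopologicalSpace G] [AlgGroupoid G] [AmpleGroupoid G]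
    [CompactSpace (units G)] (hG : IsAlmostFinite G) (F : Finset C_c(G, ℂ)) (n : ℕ) :
    ∃ K : Set G, IsElementary K ∧ ∃ (W : Set (units G)) (hW : IsClopen W),
      (∀ f ∈ F, conv f (ofUnits (1 - charFun W hW)) ∈ CcOn K ∧
        conv (ofUnits (1 - charFun W hW)) f ∈ CcOn K) ∧
      ∃ p : Fin n → C(units G, ℂ),
        (∀ i, IsStarProjection (p i)) ∧ (Pairwise fun i j => p i * p j = 0) ∧
        ∀ i, MvNEquiv (toReduced (ofUnits (p i))) (toReduced (ofUnits (charFun W hW))) := by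
  -- Openness, beyond compactness, is needed for `src '' (C \ K)` to be clopen.
  obtain ⟨C₀, hC₀c, hC₀o, hC₀⟩ := exists_compact_open_superset
    (F.isCompact_biUnion (f := fun f => tsupport f) fun f _ => f.hasCompactSupport)
  set C : Set G := C₀ ∪ (fun g => g⁻¹) ⁻¹' C₀ with hCdef
  have hCc : IsCompact C := hC₀c.union ((invHomeomorph G).isCompact_preimage.2 hC₀c)
  have hCo : IsOpen C := hC₀o.union (hC₀o.preimage EtaleGroupoid.continuous_inv')
  have hFC : ∀ f ∈ F, ∀ g, f g ≠ 0 → g ∈ C ∧ g⁻¹ ∈ C := by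
    intro f hf g hg
    have : g ∈ C₀ := hC₀ (Set.mem_biUnion hf (subset_tsupport f hg))
    exact ⟨Or.inl this, Or.inr (by simpa [inv_inv'] using this)⟩
  obtain ⟨N, hN⟩ := fiber_bound (locInj_rng (G := G)) hCc
  -- The product `n * N` absorbs `n` copies and the multiplicity `N`; the `+ 1` keeps the tolerance
  -- meaningful when `n * N = 0`.
  obtain ⟨K, hK, hinv⟩ := hG C hCc (1 / (n * N + 1)) (by positivity)
  have hKcl := hK.isCompact.isClosed
  set W₀ : Set G := src '' (C \ K) with hW₀
  have hW₀cl : IsClopen W₀ :=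
    isClopen_src_image (hCc.diff hK.isOpen) (hCo.sdiff hKcl)
  have hW₀u : W₀ ⊆ units G := by
    rintro _ ⟨g, -, rfl⟩
    exact src_mem_units g
  have hcount : ∀ x ∈ units G, n * arrowCount K x W₀ ≤ arrowCount K x (units G) := by
    intro x hx
    rw [arrowCount_units]
    have h1 := arrowCount_src_diff_le hCc hK.isSubgroupoid hK.isCompact hN x
    have h2 := hinv x hx
    have hpos : 0 < (fiber K x).ncard := by
      rw [Set.ncard_pos (finite_fiber hK.isCompact x)]
      exact ⟨x, Set.inter_eq_right.1 hK.units_eq hx, src_of_mem_units hx⟩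
    rw [div_lt_div_iff₀ (by exact_mod_cast hpos) (by positivity), one_mul] at h2
    have h3 : (setMul C (fiber K x) \ fiber K x).ncard * (n * N + 1) < (fiber K x).ncard := by
      exact_mod_cast h2
    calc n * arrowCount K x W₀
        ≤ n * (N * (setMul C (fiber K x) \ fiber K x).ncard) := Nat.mul_le_mul_left _ h1
      _ ≤ (setMul C (fiber K x) \ fiber K x).ncard * (n * N + 1) := by
          rw [← mul_assoc, mul_comm]
          exact Nat.mul_le_mul_left _ (Nat.le_succ _)
      _ ≤ _ := h3.le
  obtain ⟨V, hV, hdisj⟩ := exists_disjoint_bisections hK hW₀cl hW₀u n isClopen_units hcount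
  have hW : IsClopen (Subtype.val ⁻¹' W₀ : Set (units G)) := hW₀cl.preimage continuous_subtype_val
  have hV' : ∀ i, IsClopen (Subtype.val ⁻¹' (rng '' V i) : Set (units G)) := fun i =>
    (isClopen_rng_image (hV i).1.isCompact (hV i).1.isOpen).preimage continuous_subtype_val
  refine ⟨K, hK, Subtype.val ⁻¹' W₀, hW, fun f hf => ⟨?_, ?_⟩, fun i => charFun _ (hV' i),
    fun i => isStarProjection_charFun _,
    fun i j hij => charFun_mul_charFun_of_disjoint _ _ ((hdisj hij).preimage _),
    fun i => mvNEquiv_of_bisection (hV i).1 hW (hV' i) (fun x => by rw [(hV i).2.1]; rfl)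
      fun x => Iff.rfl⟩
  · refine conv_ofUnits_right_mem_CcOn hKcl f _ fun g hgK hfg => ?_
    rw [ContinuousMap.sub_apply, charFun_of_mem hW ⟨g, ⟨(hFC f hf g hfg).1, hgK⟩, rfl⟩,
      ContinuousMap.one_apply, sub_self]
  · refine conv_ofUnits_left_mem_CcOn hKcl f _ fun g hgK hfg => ?_
    -- The range of `g` is the source of `g⁻¹ ∈ C \ K`, hence lies in `W₀`.
    have hgK' : g⁻¹ ∉ K := fun h => hgK (inv_inv' g ▸ hK.isSubgroupoid.inv_mem _ h)
    rw [ContinuousMap.sub_apply,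
      charFun_of_mem hW ⟨g⁻¹, ⟨(hFC f hf g hfg).2, hgK'⟩, src_inv g⟩,
      ContinuousMap.one_apply, sub_self]
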